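/- Let $F_0=0$, $F_1=1$, $F_n=F_{n-1}+F_{n-2}$ be the Fibonacci numbers and let $L_0=2$ and $L_n=F_{n-1}+F_{n+1}$ for $n\ge 1$ be the Lucas numbers. Let $\mathbf f=f_0f_1f_2\cdots=01001010\cdots$ be the infinite Fibonacci word, that is, the fixed point of the morphism $0\mapsto 01$, $1\mapsto 0$. A factor of $\mathbf f$ of length $n$ is a word $f_if_{i+1}\cdots f_{i+n-1}$ with $i\ge 0$. The least period of a nonempty finite word $w$ is the smallest integer $p\ge 1$ such that $w[t]=w[t+p]$ for all $t$ for which both sides are defined, and the exponent of $w$ is $|w|$ divided by its least period. Theorem. For $n\ge 1$ let $\ell(n)$ be the smallest integer that is the least period of some length-$n$ factor of $\mathbf f$. Then $\ell(n)=F_j$ for all integers $n\ge 1$ and $j\ge 1$ such that $L_j-1\le n\le L_{j+1}-2$. Moreover, the critical exponent of $\mathbf f$, that is, the supremum of the exponents of all nonempty factors of $\mathbf f$, equals $2+\alpha$, where $\alpha=(1+\sqrt5)/2$. -/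

import Mathlib

namespace FibWord

/-- The morphism `0 ↦ 01`, `1 ↦ 0` on letters. -/
def morph : Fin 2 → List (Fin 2)
  | 0 => [0, 1]
  | 1 => [0]

/-- The finite word obtained by applying the morphism `m` times to the word `0`. -/
def iter : ℕ → List (Fin 2)
  | 0 => [0]
  | m + 1 => (iter m).flatMap morph

/-- The infinite Fibonacci word `f = 01001010…`, the fixed point of `0 ↦ 01`, `1 ↦ 0`: its letter
at position `n` is the letter at position `n` of the `n`-fold image of `0` (a word of length
greater than `n`, see `lt_length_iter`; all these images are prefixes of `f`, see
`iter_getElem?`). -/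
def fibonacciWord (n : ℕ) : Fin 2 := (iter n).getD n 0

theorem iter_add_two (m : ℕ) : iter (m + 2) = iter (m + 1) ++ iter m := by
  induction m with
  | zero => rfl
  | succ k ih =>
    have h := congrArg (List.flatMap morph) ih
    rwa [List.flatMap_append] at h

theorem length_iter (m : ℕ) : (iter m).length = Nat.fib (m + 2) := by
  induction m using Nat.twoStepInduction with
  | zero => rfl
  | one => rfl
  | more k h0 h1 =>
    rw [iter_add_two, List.length_append, h0, h1, Nat.fib_add_two (n := k + 2), add_comm]

theorem lt_length_iter (m : ℕ) : m < (iter m).length := by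
  induction m using Nat.twoStepInduction with
  | zero => decide
  | one => decide
  | more k h0 h1 =>
    rw [iter_add_two, List.length_append]
    omega

theorem iter_prefix_succ (m : ℕ) : iter m <+: iter (m + 1) := by
  cases m with
  | zero => exact ⟨[1], rfl⟩
  | succ k => exact ⟨iter k, (iter_add_two k).symm⟩

theorem iter_prefix {m n : ℕ} (h : m ≤ n) : iter m <+: iter n := by
  induction n, h using Nat.le_induction with
  | base => exact List.prefix_rfl
  | succ n _ ih => exact ih.trans (iter_prefix_succ n)

/-- Every word `iter m` is a prefix of the Fibonacci word. -/
theorem iter_getElem? {m i : ℕ} (h : i < (iter m).length) :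
    (iter m)[i]? = some (fibonacciWord i) := by
  have hi : i < (iter i).length := lt_length_iter i
  have key : (iter m)[i]? = (iter i)[i]? := by
    rcases le_total m i with hmi | him
    · exact (((List.prefix_iff_getElem?.1 (iter_prefix hmi)) i h).trans
        (List.getElem?_eq_getElem h).symm).symm
    · exact ((List.prefix_iff_getElem?.1 (iter_prefix him)) i hi).trans
        (List.getElem?_eq_getElem hi).symm
  rw [key, fibonacciWord, List.getD_eq_getElem?_getD, List.getElem?_eq_getElem hi]
  rfl

/-- The factor `x[i..i+n-1]` of length `n` at position `i` of the infinite word `x`. -/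
def factor {A : Type*} (x : ℕ → A) (i n : ℕ) : List A :=
  (List.range n).map fun t => x (i + t)

/-- The least period of a finite word `w`: the smallest integer `p ≥ 1` such that
`w[i] = w[i+p]` whenever both sides are meaningful. (The length of a nonempty word is such a
`p`, so the set is never empty.) -/
noncomputable def leastPeriod {A : Type*} (w : List A) : ℕ :=
  sInf {p : ℕ | 1 ≤ p ∧ w.HasPeriod p}

/-- The exponent `|w| / P` of a finite word `w`, where `P` is its least period. -/
noncomputable def exponent {A : Type*} (w : List A) : ℝ :=
  (w.length : ℝ) / (leastPeriod w : ℝ)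

/-- `c` is the critical exponent of the infinite word `x`: the supremum of the exponents of its
nonempty factors. -/
def IsCriticalExponent {A : Type*} (x : ℕ → A) (c : ℝ) : Prop :=
  IsLUB {e : ℝ | ∃ i n : ℕ, 1 ≤ n ∧ e = exponent (factor x i n)} c

/-- The Lucas numbers `L_n = F_{n-1} + F_{n+1}`, with `F_{-1} = 1`: `2, 1, 3, 4, 7, 11, …`. -/
def lucas : ℕ → ℕ
  | 0 => 2
  | n + 1 => Nat.fib n + Nat.fib (n + 2)

end FibWord

namespace FibWord

open Real

/-! ### Diophantine approximation of the golden ratio -/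

/-! The word codes the rotation by `φ`: its letters are read off the differences of `⌊nφ⌋`
(`fibonacciWord_eq_floor`). Agreement with the shift by `p` along a run makes `⌊(x+p)φ⌋ - ⌊xφ⌋`
constant there. This difference takes two values, decided by arcs no shorter than the distance of
`pφ` to the integers, and consecutive multiples of `φ` soon visit both (`exists_lt_fib_hits`). So a
run is long only if `p` approximates `φ` well, and Fibonacci numbers do so best; hence
`length_lt_of_hasPeriod`. Conversely, `fibonacciWord_run` gives a factor of length `L_{j+1} - 2`
with period `F_j`, and `L_{j+1} / F_j` tends to `2 + φ`. Throughout, `-goldenConj` is `1/φ`. -/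

theorem fib_mul_goldenRatio (k : ℕ) :
    (Nat.fib k : ℝ) * goldenRatio = Nat.fib (k + 1) - goldenConj ^ k := by
  linarith [fib_succ_sub_goldenRatio_mul_fib k]

theorem abs_goldenConj : |goldenConj| = -goldenConj := abs_of_neg goldenConj_neg

theorem neg_goldenConj_pow_pos (k : ℕ) : 0 < (-goldenConj) ^ k :=
  pow_pos (neg_pos.2 goldenConj_neg) k

theorem neg_goldenConj_pow_add_two (k : ℕ) :
    (-goldenConj) ^ (k + 2) = (-goldenConj) ^ k - (-goldenConj) ^ (k + 1) := by
  have h := goldenConj_sq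
  linear_combination (-goldenConj) ^ k * h

/-- Consecutive pairs of Fibonacci numbers form a basis of `ℤ²`. -/
theorem exists_fib_coords (k : ℕ) (p s : ℤ) : ∃ u v : ℤ,
    p = u * Nat.fib (k + 2) + v * Nat.fib (k + 1) ∧
    s = u * Nat.fib (k + 3) + v * Nat.fib (k + 2) := by
  induction k with
  | zero => exact ⟨s - p, 2 * p - s, by simp; ring, by simp [Nat.fib_add_two]; ring⟩
  | succ k ih =>
    obtain ⟨u, v, hp, hs⟩ := ih
    refine ⟨v, u - v, ?_, ?_⟩
    · rw [hp, Nat.fib_add_two (n := k + 1)]; push_cast; ring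
    · rw [hs, Nat.fib_add_two (n := k + 2)]; push_cast; ring

/-- Reduces approximation of `φ` to bounding `|v - u/φ|` from below over integer coordinates. -/
theorem abs_mul_goldenRatio_sub (k : ℕ) (u v : ℤ) :
    |((u * Nat.fib (k + 2) + v * Nat.fib (k + 1) : ℤ) : ℝ) * goldenRatio -
      ((u * Nat.fib (k + 3) + v * Nat.fib (k + 2) : ℤ) : ℝ)| =
    (-goldenConj) ^ (k + 1) * |v - u * (-goldenConj)| := by
  have h1 := fib_mul_goldenRatio (k + 1)
  have h2 := fib_mul_goldenRatio (k + 2)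
  have : ((u * Nat.fib (k + 2) + v * Nat.fib (k + 1) : ℤ) : ℝ) * goldenRatio -
      ((u * Nat.fib (k + 3) + v * Nat.fib (k + 2) : ℤ) : ℝ) =
      -(goldenConj ^ (k + 1) * (v - u * (-goldenConj))) := by
    push_cast
    linear_combination (v : ℝ) * h1 + (u : ℝ) * h2
  rw [this, abs_neg, abs_mul, abs_pow, abs_goldenConj]

/-- The sign pattern of the coordinates of a point whose first entry is small. -/
theorem fib_coords_cases {k : ℕ} {u v : ℤ}
    (h0 : 0 < u * Nat.fib (k + 2) + v * Nat.fib (k + 1))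
    (h1 : u * Nat.fib (k + 2) + v * Nat.fib (k + 1) < Nat.fib (k + 2)) :
    (u = 0 ∧ v = 1) ∨ (u = 0 ∧ 2 ≤ v) ∨ (1 ≤ v ∧ u ≤ -1) ∨ (v ≤ -1 ∧ 1 ≤ u) := by
  have a : (0 : ℤ) < Nat.fib (k + 2) := by exact_mod_cast Nat.fib_pos.2 (by omega)
  have b : (0 : ℤ) < Nat.fib (k + 1) := by exact_mod_cast Nat.fib_pos.2 (by omega)
  rcases lt_trichotomy u 0 with hu | rfl | hu
  · have : 1 ≤ v := by
      by_contra h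
      nlinarith [mul_nonneg (show 0 ≤ -v by omega) b.le, mul_nonneg (show 0 ≤ -u by omega) a.le]
    omega
  · have : 1 ≤ v := by
      by_contra h
      nlinarith [mul_nonneg (show 0 ≤ -v by omega) b.le]
    omega
  · have : v ≤ -1 := by
      by_contra h
      nlinarith [mul_nonneg (show 0 ≤ v by omega) b.le, mul_nonneg (show 0 ≤ u - 1 by omega) a.le]
    omega

/-- Fibonacci numbers give the best approximations of the golden ratio. -/
theorem pow_succ_le_abs_mul_goldenRatio_sub {k : ℕ} {p : ℤ} (s : ℤ) (h0 : 0 < p)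
    (h1 : p < Nat.fib (k + 2)) : (-goldenConj) ^ (k + 1) ≤ |p * goldenRatio - s| := by
  obtain ⟨u, v, rfl, rfl⟩ := exists_fib_coords k p s
  rw [abs_mul_goldenRatio_sub]
  refine le_mul_of_one_le_right (neg_goldenConj_pow_pos _).le ?_
  have hr := goldenConj_neg
  rcases fib_coords_cases h0 h1 with ⟨rfl, rfl⟩ | ⟨rfl, h⟩ | ⟨hv, hu⟩ | ⟨hv, hu⟩
  · simp
  · have : (2 : ℝ) ≤ v := by exact_mod_cast h
    exact le_abs.2 (Or.inl (by push_cast; linarith))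
  · have hv : (1 : ℝ) ≤ v := by exact_mod_cast hv
    have hu : (u : ℝ) ≤ -1 := by exact_mod_cast hu
    exact le_abs.2 (Or.inl (by nlinarith))
  · have hv : (v : ℝ) ≤ -1 := by exact_mod_cast hv
    have hu : (1 : ℝ) ≤ u := by exact_mod_cast hu
    exact le_abs.2 (Or.inr (by nlinarith))

/-- Apart from the Fibonacci number itself, the approximations are worse by one power. -/
theorem pow_le_abs_mul_goldenRatio_sub {k : ℕ} {p : ℤ} (s : ℤ) (h0 : 0 < p)
    (h1 : p < Nat.fib (k + 2)) (h2 : p ≠ Nat.fib (k + 1)) :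
    (-goldenConj) ^ k ≤ |p * goldenRatio - s| := by
  obtain ⟨u, v, rfl, rfl⟩ := exists_fib_coords k p s
  rw [abs_mul_goldenRatio_sub]
  have hr := goldenConj_neg
  have hr1 := neg_one_lt_goldenConj
  have hsq := goldenConj_sq
  -- The bound is `φ`, attained at `(u, v) = (-1, 1)`. Opposite signs of `u` and `v` prevent
  -- cancellation.
  have key : 1 - goldenConj ≤ |v - u * (-goldenConj)| := by
    rcases fib_coords_cases h0 h1 with ⟨rfl, rfl⟩ | ⟨rfl, h⟩ | ⟨hv, hu⟩ | ⟨hv, hu⟩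
    · simp at h2
    · have : (2 : ℝ) ≤ v := by exact_mod_cast h
      exact le_abs.2 (Or.inl (by push_cast; linarith))
    · have hv : (1 : ℝ) ≤ v := by exact_mod_cast hv
      have hu : (u : ℝ) ≤ -1 := by exact_mod_cast hu
      exact le_abs.2 (Or.inl (by nlinarith))
    · have hv : (v : ℝ) ≤ -1 := by exact_mod_cast hv
      have hu : (1 : ℝ) ≤ u := by exact_mod_cast hu
      exact le_abs.2 (Or.inr (by nlinarith))
  have hp := neg_goldenConj_pow_pos k
  calc (-goldenConj) ^ k = (-goldenConj) ^ (k + 1) * (1 - goldenConj) := by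
        rw [pow_succ]; linear_combination (-(-goldenConj) ^ k) * hsq
    _ ≤ _ := mul_le_mul_of_nonneg_left key (neg_goldenConj_pow_pos _).le

/-- Any `F_{k+2}` consecutive multiples of the golden ratio visit each half-open arc of length
`φ⁻ᵏ` of the circle `ℝ / ℤ`. -/
theorem exists_lt_fib_hits (k : ℕ) (y : ℝ) : ∃ t : ℕ, t < Nat.fib (k + 2) ∧ ∃ s : ℤ,
    0 ≤ y + t * goldenRatio - s ∧ y + t * goldenRatio - s < (-goldenConj) ^ k := by
  induction k with
  | zero => exact ⟨0, by simp, ⌊y⌋, by simp, by simp [Int.fract_lt_one]⟩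
  | succ k ih =>
    obtain ⟨t, ht, s, h0, h1⟩ := ih
    have hf : Nat.fib (k + 3) = Nat.fib (k + 1) + Nat.fib (k + 2) := Nat.fib_add_two
    have e1 := fib_mul_goldenRatio (k + 1)
    have e2 := fib_mul_goldenRatio (k + 2)
    have hk := neg_goldenConj_pow_add_two k
    have hp1 := neg_goldenConj_pow_pos (k + 1)
    have hp2 := neg_goldenConj_pow_pos (k + 2)
    have hp3 := neg_goldenConj_pow_pos (k + 3)
    have hk' := neg_goldenConj_pow_add_two (k + 1)
    by_cases hlt : y + t * goldenRatio - s < (-goldenConj) ^ (k + 1)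
    · exact ⟨t, by show t < Nat.fib (k + 3); omega, s, h0, hlt⟩
    -- The hit lies in the top part of the arc, so it must be moved down. By parity, adding
    -- `F_{k+1}` lowers it by `φ^{-(k+1)}`, or adding `F_{k+2}` or subtracting `F_{k+1}` lowers it
    -- by `φ^{-(k+2)}` or `φ^{-(k+1)}`.
    push Not at hlt
    rcases Nat.even_or_odd (k + 1) with he | ho
    · rw [← he.neg_pow goldenConj] at e1
      refine ⟨t + Nat.fib (k + 1), by show _ < Nat.fib (k + 3); omega, s + Nat.fib (k + 2), ?_, ?_⟩
      · push_cast; linarith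
      · push_cast; linarith
    · rw [← neg_neg (goldenConj ^ (k + 1)), ← ho.neg_pow goldenConj] at e1
      rw [← (show Even (k + 2) from ho.add_one).neg_pow goldenConj] at e2
      by_cases htl : t < Nat.fib (k + 1)
      · refine ⟨t + Nat.fib (k + 2), by show _ < Nat.fib (k + 3); omega,
          s + Nat.fib (k + 3), ?_, ?_⟩
        · push_cast; linarith
        · push_cast; linarith
      · push Not at htl
        refine ⟨t - Nat.fib (k + 1), by show _ < Nat.fib (k + 3); omega,
          s - Nat.fib (k + 2), ?_, ?_⟩
        · push_cast [Nat.cast_sub htl]; linarith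
        · push_cast [Nat.cast_sub htl]; linarith

/-! ### The Fibonacci word as a Sturmian word -/

/-- `F_{k+1}φ` is within `φ^{-(k+1)}` of `F_{k+2}`, while `Nφ` is at least that far from every
integer. Irrationality excludes equality at the upper end. -/
theorem floor_fib_add_mul_goldenRatio {k N : ℕ} (h0 : 0 < N) (h1 : N < Nat.fib (k + 2)) :
    ⌊((Nat.fib (k + 1) + N : ℕ) : ℝ) * goldenRatio⌋ =
      Nat.fib (k + 2) + ⌊(N : ℝ) * goldenRatio⌋ := by
  set s := ⌊(N : ℝ) * goldenRatio⌋ with hs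
  have a0 : (s : ℝ) ≤ N * goldenRatio := Int.floor_le _
  have a1 : (N : ℝ) * goldenRatio < s + 1 := Int.lt_floor_add_one _
  have b0 := pow_succ_le_abs_mul_goldenRatio_sub (k := k) (p := N) s (by omega) (by omega)
  have b1 := pow_succ_le_abs_mul_goldenRatio_sub (k := k) (p := N) (s + 1) (by omega) (by omega)
  have e1 := fib_mul_goldenRatio (k + 1)
  have habs : |goldenConj ^ (k + 1)| = (-goldenConj) ^ (k + 1) := by rw [abs_pow, abs_goldenConj]
  have c := abs_le.1 habs.le
  push_cast at b0 b1
  rw [abs_of_nonneg (by linarith)] at b0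
  rw [abs_of_neg (by linarith)] at b1
  have irr : ((Nat.fib (k + 1) + N : ℕ) : ℝ) * goldenRatio ≠
      ((Nat.fib (k + 2) + s + 1 : ℤ) : ℝ) :=
    (goldenRatio_irrational.natCast_mul (by omega)).ne_int _
  rw [Int.floor_eq_iff]
  push_cast at irr ⊢
  refine ⟨by linarith, lt_of_le_of_ne (by linarith) irr⟩

theorem fibonacciWord_fib_add {m i : ℕ} (hi : i < Nat.fib (m + 2)) :
    fibonacciWord (Nat.fib (m + 3) + i) = fibonacciWord i := by
  have hl : (iter (m + 1)).length = Nat.fib (m + 3) := length_iter (m + 1)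
  have h1 := iter_getElem? (m := m + 2) (i := Nat.fib (m + 3) + i) (by
    rw [length_iter, Nat.fib_add_two (n := m + 2)]; show _ + _ < _ + Nat.fib (m + 3); omega)
  rw [iter_add_two, List.getElem?_append_right (by omega), hl, Nat.add_sub_cancel_left,
    iter_getElem? (by rwa [length_iter])] at h1
  exact (Option.some.inj h1).symm

theorem floor_goldenRatio_mul_small :
    ⌊((1 : ℕ) : ℝ) * goldenRatio⌋ = 1 ∧ ⌊((2 : ℕ) : ℝ) * goldenRatio⌋ = 3 ∧
      ⌊((3 : ℕ) : ℝ) * goldenRatio⌋ = 4 := by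
  have h := goldenRatio_sq
  have h1 := one_lt_goldenRatio
  have h2 : 3 / 2 < goldenRatio := by nlinarith
  have h3 : goldenRatio < 5 / 3 := by nlinarith
  refine ⟨?_, ?_, ?_⟩ <;> rw [Int.floor_eq_iff] <;> push_cast <;> constructor <;> linarith

/-- The Fibonacci word is the sequence of differences of `⌊nφ⌋`. -/
theorem fibonacciWord_eq_floor (n : ℕ) : ((fibonacciWord n : ℕ) : ℤ) =
    2 - (⌊((n + 2 : ℕ) : ℝ) * goldenRatio⌋ - ⌊((n + 1 : ℕ) : ℝ) * goldenRatio⌋) := by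
  induction n using Nat.strong_induction_on with
  | _ n ih =>
    obtain ⟨f1, f2, f3⟩ := floor_goldenRatio_mul_small
    match n, ih with
    | 0, _ => rw [f1, f2]; rfl
    | 1, _ => rw [f2, f3]; rfl
    | n + 2, ih =>
      -- Removing the largest Fibonacci number from the index preserves both sides.
      obtain ⟨m, hm0, hm1⟩ : ∃ m, Nat.fib (m + 3) ≤ n + 2 ∧ n + 2 < Nat.fib (m + 4) := by
        have h3 : 3 ≤ Nat.greatestFib (n + 2) := by
          rw [Nat.le_greatestFib]; simp [Nat.fib_add_two]
        refine ⟨Nat.greatestFib (n + 2) - 3, ?_, ?_⟩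
        · rw [Nat.sub_add_cancel h3]; exact Nat.fib_greatestFib_le _
        · rw [show Nat.greatestFib (n + 2) - 3 + 4 = Nat.greatestFib (n + 2) + 1 by omega]
          exact Nat.lt_fib_greatestFib_add_one _
      obtain ⟨i, hi⟩ := Nat.exists_eq_add_of_le hm0
      have e4 : Nat.fib (m + 4) = Nat.fib (m + 2) + Nat.fib (m + 3) := Nat.fib_add_two
      have e3 : Nat.fib (m + 3) = Nat.fib (m + 1) + Nat.fib (m + 2) := Nat.fib_add_two
      have p2 : 0 < Nat.fib (m + 2) := Nat.fib_pos.2 (by omega)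
      have p1 : 0 < Nat.fib (m + 1) := Nat.fib_pos.2 (by omega)
      rw [hi, fibonacciWord_fib_add (by omega), ih i (by omega), add_assoc, add_assoc,
        floor_fib_add_mul_goldenRatio (k := m + 2) (by omega)
          (by show _ < Nat.fib (m + 4); omega),
        floor_fib_add_mul_goldenRatio (k := m + 2) (by omega)
          (by show _ < Nat.fib (m + 4); omega)]
      ring

theorem fibonacciWord_eq_iff (a b : ℕ) : fibonacciWord a = fibonacciWord b ↔
    ⌊((a + 2 : ℕ) : ℝ) * goldenRatio⌋ - ⌊((a + 1 : ℕ) : ℝ) * goldenRatio⌋ =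
    ⌊((b + 2 : ℕ) : ℝ) * goldenRatio⌋ - ⌊((b + 1 : ℕ) : ℝ) * goldenRatio⌋ := by
  rw [Fin.ext_iff, ← Nat.cast_inj (R := ℤ), fibonacciWord_eq_floor, fibonacciWord_eq_floor]
  omega

/-- The floor formula gives a longer range than the concatenation rule `fibonacciWord_fib_add`; the
extremal runs need it. -/
theorem fibonacciWord_fib_add_of_lt {k i : ℕ} (h : i + 2 < Nat.fib (k + 2)) :
    fibonacciWord (Nat.fib (k + 1) + i) = fibonacciWord i := by
  rw [fibonacciWord_eq_iff, add_assoc, add_assoc,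
    floor_fib_add_mul_goldenRatio (by omega) h,
    floor_fib_add_mul_goldenRatio (by omega) (by omega)]
  ring

/-- A long run of period `F_j`. -/
theorem fibonacciWord_run {j t : ℕ} (h : t + 2 < Nat.fib (j + 2)) :
    fibonacciWord (Nat.fib (j + 1) + t) = fibonacciWord (Nat.fib (j + 1) + t + Nat.fib j) := by
  have e2 : Nat.fib (j + 2) = Nat.fib j + Nat.fib (j + 1) := Nat.fib_add_two
  have e3 : Nat.fib (j + 3) = Nat.fib (j + 1) + Nat.fib (j + 2) := Nat.fib_add_two
  rw [fibonacciWord_fib_add_of_lt h,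
    show Nat.fib (j + 1) + t + Nat.fib j = Nat.fib (j + 2) + t by omega,
    fibonacciWord_fib_add_of_lt (k := j + 1) (by show _ < Nat.fib (j + 3); omega)]

/-- If `p` is badly approximable, then no long factor of the Fibonacci word reoccurs at
distance `p`. -/
theorem lt_fib_of_forall_eq {k p i m : ℕ}
    (hp : ∀ s : ℤ, (-goldenConj) ^ k ≤ |(p : ℝ) * goldenRatio - s|)
    (h : ∀ t < m, fibonacciWord (i + t) = fibonacciWord (i + t + p)) :
    m + 1 < Nat.fib (k + 2) := by
  by_contra! hm
  let D : ℕ → ℤ := fun t =>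
    ⌊((i + t + p + 1 : ℕ) : ℝ) * goldenRatio⌋ - ⌊((i + t + 1 : ℕ) : ℝ) * goldenRatio⌋
  have hD : ∀ t ≤ m, D t = D 0 := by
    intro t
    induction t with
    | zero => simp
    | succ t ih =>
      intro ht
      rw [← ih (by omega)]
      have := (fibonacciWord_eq_iff _ _).1 (h t (by omega))
      simp only [D]
      rw [show i + (t + 1) + p + 1 = i + t + p + 2 by ring, show i + (t + 1) + 1 = i + t + 2 by ring]
      omega
  set s0 := ⌊(p : ℝ) * goldenRatio⌋ with hs0
  have a0 : (s0 : ℝ) ≤ p * goldenRatio := Int.floor_le _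
  have a1 : (p : ℝ) * goldenRatio < s0 + 1 := Int.lt_floor_add_one _
  have b0 := hp s0
  have b1 := hp (s0 + 1)
  push_cast at b1
  rw [abs_of_nonneg (by linarith)] at b0
  rw [abs_of_neg (by linarith)] at b1
  -- One hit just above an integer and one just below it force different values of `D`.
  obtain ⟨t, ht, s, c0, c1⟩ := exists_lt_fib_hits k ((i + 1 : ℕ) * goldenRatio)
  obtain ⟨t', ht', s', d0, d1⟩ :=
    exists_lt_fib_hits k ((i + 1 : ℕ) * goldenRatio + (-goldenConj) ^ k)
  have hq := neg_goldenConj_pow_pos k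
  have D1 : D t = s0 := by
    have e1 : ⌊((i + t + 1 : ℕ) : ℝ) * goldenRatio⌋ = s := by
      rw [Int.floor_eq_iff]; push_cast at *; constructor <;> linarith
    have e2 : ⌊((i + t + p + 1 : ℕ) : ℝ) * goldenRatio⌋ = s + s0 := by
      rw [Int.floor_eq_iff]; push_cast at *; constructor <;> linarith
    simp only [D, e1, e2]; ring
  have D2 : s0 + 1 ≤ D t' := by
    have e1 : ⌊((i + t' + 1 : ℕ) : ℝ) * goldenRatio⌋ = s' - 1 := by
      rw [Int.floor_eq_iff]; push_cast at *; constructor <;> linarith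
    have e2 : s' + s0 ≤ ⌊((i + t' + p + 1 : ℕ) : ℝ) * goldenRatio⌋ := by
      rw [Int.le_floor]; push_cast at *; linarith
    simp only [D, e1]; omega
  have := hD t (by omega)
  have := hD t' (by omega)
  omega

/-! ### Periods of factors -/

theorem length_factor {A : Type*} (x : ℕ → A) (i n : ℕ) : (factor x i n).length = n := by
  simp [factor]

theorem hasPeriod_factor_iff {A : Type*} (x : ℕ → A) (i n p : ℕ) :
    (factor x i n).HasPeriod p ↔ ∀ t < n - p, x (i + t) = x (i + t + p) := by
  rw [List.hasPeriod_iff_getElem?, length_factor]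
  refine forall₂_congr fun t ht => ?_
  rw [factor, List.getElem?_map, List.getElem?_map, List.getElem?_range (by omega),
    List.getElem?_range (by omega)]
  simp [add_assoc]

theorem leastPeriod_mem {A : Type*} {w : List A} (hw : 1 ≤ w.length) :
    1 ≤ leastPeriod w ∧ w.HasPeriod (leastPeriod w) :=
  Nat.sInf_mem (s := {p : ℕ | 1 ≤ p ∧ w.HasPeriod p})
    ⟨w.length, hw, List.hasPeriod_of_length_le w _ le_rfl⟩

theorem lucas_add_fib (j : ℕ) (hj : 1 ≤ j) :
    lucas j = Nat.fib (j - 1) + Nat.fib (j + 1) := by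
  obtain ⟨j, rfl⟩ := Nat.exists_eq_add_of_le' hj
  rfl

/-- A factor with a period smaller than `F_j` has length at most `L_j - 2`. -/
theorem length_lt_of_hasPeriod {i n p j : ℕ} (hp : 1 ≤ p) (hj : p < Nat.fib j)
    (h : (factor fibonacciWord i n).HasPeriod p) : n + 1 < lucas j := by
  rw [hasPeriod_factor_iff] at h
  obtain ⟨k, rfl⟩ : ∃ k, j = k + 2 := by
    match j, hj with
    | 0, hj => simp at hj
    | 1, hj => simp at hj; omega
    | k + 2, _ => exact ⟨k, rfl⟩
  have e2 : Nat.fib (k + 2) = Nat.fib k + Nat.fib (k + 1) := Nat.fib_add_two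
  have e3 : Nat.fib (k + 3) = Nat.fib (k + 1) + Nat.fib (k + 2) := Nat.fib_add_two
  have hmono : Nat.fib k ≤ Nat.fib (k + 1) := Nat.fib_le_fib_succ
  change n + 1 < Nat.fib (k + 1) + Nat.fib (k + 3)
  -- Only `F_{k+1}` needs the weaker approximation bound; the longer run it allows is offset by its
  -- smaller size.
  by_cases hpk : p = Nat.fib (k + 1)
  · have : n - p + 1 < Nat.fib (k + 3) := lt_fib_of_forall_eq (k := k + 1)
      (fun s => by
        simpa using pow_succ_le_abs_mul_goldenRatio_sub (k := k) (p := p) s (by omega) (by omega))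
      h
    omega
  · have := lt_fib_of_forall_eq (k := k) (fun s => by
      simpa using pow_le_abs_mul_goldenRatio_sub (k := k) (p := p) s (by omega) (by omega)
        (by exact_mod_cast hpk)) h
    omega

theorem fib_le_leastPeriod {i n j : ℕ} (hn : 1 ≤ n) (h : lucas j ≤ n + 1) :
    Nat.fib j ≤ leastPeriod (factor fibonacciWord i n) := by
  obtain ⟨h1, h2⟩ := leastPeriod_mem (w := factor fibonacciWord i n) (by rwa [length_factor])
  by_contra! hlt
  exact absurd (length_lt_of_hasPeriod h1 hlt h2) (by omega)

theorem leastPeriod_factor_fib {n j : ℕ} (hn : 1 ≤ n) (hj : 1 ≤ j) (h1 : lucas j ≤ n + 1)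
    (h2 : n + 2 ≤ lucas (j + 1)) :
    leastPeriod (factor fibonacciWord (Nat.fib (j + 1)) n) = Nat.fib j := by
  refine le_antisymm (Nat.sInf_le ⟨Nat.fib_pos.2 hj, ?_⟩) (fib_le_leastPeriod hn h1)
  rw [hasPeriod_factor_iff]
  intro t ht
  change n + 2 ≤ Nat.fib j + Nat.fib (j + 2) at h2
  exact fibonacciWord_run (by omega)

theorem isLeast_leastPeriod {n j : ℕ} (hn : 1 ≤ n) (hj : 1 ≤ j) (h1 : lucas j ≤ n + 1)
    (h2 : n + 2 ≤ lucas (j + 1)) :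
    IsLeast {p : ℕ | ∃ i : ℕ, p = leastPeriod (factor fibonacciWord i n)} (Nat.fib j) := by
  refine ⟨⟨_, (leastPeriod_factor_fib hn hj h1 h2).symm⟩, ?_⟩
  rintro p ⟨i, rfl⟩
  exact fib_le_leastPeriod hn h1

/-! ### The critical exponent -/

theorem abs_goldenConj_pow_le_one (k : ℕ) : |goldenConj ^ k| ≤ 1 := by
  rw [abs_pow]
  refine pow_le_one₀ (abs_nonneg _) ?_
  rw [abs_goldenConj]
  linarith [neg_one_lt_goldenConj]

theorem exponent_factor_le {i n : ℕ} (hn : 1 ≤ n) :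
    exponent (factor fibonacciWord i n) ≤ 2 + goldenRatio := by
  obtain ⟨h1, h2⟩ := leastPeriod_mem (w := factor fibonacciWord i n) (by rwa [length_factor])
  rw [exponent, length_factor]
  set p := leastPeriod (factor fibonacciWord i n) with hp
  have hp0 : (0 : ℝ) < p := by exact_mod_cast h1
  rw [div_le_iff₀ hp0]
  -- Now `n + 2 ≤ L_{k+1} = (2+φ)F_k + goldenConj ^ k`, and the `2` absorbs the error term.
  set k := Nat.greatestFib p with hk
  have hk0 : Nat.fib k ≤ p := Nat.fib_greatestFib_le p
  have hlt := length_lt_of_hasPeriod h1 (Nat.lt_fib_greatestFib_add_one p) h2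
  change n + 1 < Nat.fib k + Nat.fib (k + 2) at hlt
  rw [Nat.fib_add_two] at hlt
  have hlt' : (n : ℝ) + 2 ≤ Nat.fib k + (Nat.fib k + Nat.fib (k + 1)) := by exact_mod_cast hlt
  have hk' : (Nat.fib k : ℝ) ≤ p := by exact_mod_cast hk0
  have := fib_mul_goldenRatio k
  have := abs_le.1 (abs_goldenConj_pow_le_one k)
  nlinarith [goldenRatio_pos]

/-- The longest factors of period `F_j` have exponents close to `2 + φ`. -/
theorem exists_exponent_ge (j : ℕ) (hj : 3 ≤ j) : ∃ n : ℕ, 1 ≤ n ∧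
    2 + goldenRatio - 3 / Nat.fib j ≤
      exponent (factor fibonacciWord (Nat.fib (j + 1)) n) := by
  have hf : 2 ≤ Nat.fib j := Nat.fib_mono hj
  have e1 : Nat.fib (j + 1) = Nat.fib (j - 1) + Nat.fib j := by
    obtain ⟨j, rfl⟩ := Nat.exists_eq_add_of_le' (show 1 ≤ j by omega)
    exact Nat.fib_add_two
  have e2 : Nat.fib (j + 2) = Nat.fib j + Nat.fib (j + 1) := Nat.fib_add_two
  have e3 : Nat.fib (j - 1) ≤ Nat.fib j := Nat.fib_mono (by omega)
  -- Here `n = L_{j+1} - 2`; the `3` in the bound is this `2` plus at most `1` from `goldenConj ^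
  -- j`.
  obtain ⟨n, hn⟩ : ∃ n, n + 2 = Nat.fib j + Nat.fib (j + 2) :=
    ⟨Nat.fib j + Nat.fib (j + 2) - 2, by omega⟩
  refine ⟨n, by omega, ?_⟩
  rw [exponent, length_factor, leastPeriod_factor_fib (by omega) (by omega)
    (by rw [lucas_add_fib j (by omega)]; omega) hn.le]
  have hf0 : (0 : ℝ) < Nat.fib j := by exact_mod_cast (show 0 < Nat.fib j by omega)
  have hn' : (n : ℝ) + 2 = Nat.fib j + (Nat.fib j + Nat.fib (j + 1)) := by
    exact_mod_cast hn.trans (by rw [e2])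
  rw [le_div_iff₀ hf0, sub_mul, div_mul_cancel₀ _ hf0.ne']
  have := fib_mul_goldenRatio j
  have := abs_le.1 (abs_goldenConj_pow_le_one j)
  linarith

theorem isCriticalExponent_fibonacciWord :
    IsCriticalExponent fibonacciWord (2 + goldenRatio) := by
  refine ⟨?_, fun b hb => ?_⟩
  · rintro e ⟨i, n, hn, rfl⟩
    exact exponent_factor_le hn
  · refine le_of_forall_pos_lt_add fun ε hε => ?_
    obtain ⟨N, hN⟩ := exists_nat_gt (3 / ε)
    obtain ⟨n, hn, h⟩ := exists_exponent_ge (N + 5) (by omega)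
    have hb' := hb ⟨Nat.fib (N + 5 + 1), n, hn, rfl⟩
    have hle : N + 5 ≤ Nat.fib (N + 5) := Nat.le_fib_self (by omega)
    have hle' : (N : ℝ) + 5 ≤ Nat.fib (N + 5) := by exact_mod_cast hle
    have : 3 / (Nat.fib (N + 5) : ℝ) < ε := by
      rw [div_lt_iff₀ hε] at hN
      rw [div_lt_iff₀ (by linarith [Nat.cast_nonneg (α := ℝ) N])]
      nlinarith
    linarith

end FibWord

theorem mainTheorem7 :
    (∀ n j : ℕ, 1 ≤ n → 1 ≤ j →
      FibWord.lucas j ≤ n + 1 → n + 2 ≤ FibWord.lucas (j + 1) →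
      IsLeast {p : ℕ | ∃ i : ℕ,
        p = FibWord.leastPeriod (FibWord.factor FibWord.fibonacciWord i n)} (Nat.fib j)) ∧
    FibWord.IsCriticalExponent FibWord.fibonacciWord (2 + Real.goldenRatio) := by
  exact ⟨fun _ _ hn hj h1 h2 => FibWord.isLeast_leastPeriod hn hj h1 h2,
    FibWord.isCriticalExponent_fibonacciWord⟩
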